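/- **Theorem 1.1.** Let $F_2$ be the free group on two generators. For $g\in F_2$ let $\lambda_g\in B(\ell^2(F_2))$ be the left translation operator $(\lambda_g f)(x)=f(g^{-1}x)$, and let $C^*_{\mathrm{red}}(F_2)$ be the reduced group $C^*$-algebra of $F_2$, i.e. the operator-norm closure in $B(\ell^2(F_2))$ of the linear span of $\{\lambda_g : g\in F_2\}$. Then $C^*_{\mathrm{red}}(F_2)$ has stable rank one, i.e. its group of invertible elements is norm dense in $C^*_{\mathrm{red}}(F_2)$. -/

import Mathlib

open scoped ENNReal

noncomputable section

/-- The Hilbert space `ℓ²(G)` of square-summable complex functions on a (discrete) set `G`. -/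
abbrev EllTwo (G : Type*) : Type _ := lp (fun _ : G => ℂ) 2

section LeftRegular

variable {G : Type*} [Group G]

theorem memℓp_leftTranslate (g : G) (f : EllTwo G) :
    Memℓp (fun x : G => f (g⁻¹ * x)) 2 := by
  have h := (lp.memℓp f).summable (by norm_num)
  exact memℓp_gen ((Equiv.mulLeft g⁻¹).summable_iff.2 h)

/-- Left translation by `g` on `ℓ²(G)`, `(λ_g f)(x) = f (g⁻¹ x)`, as a linear isometry. -/
def leftTranslate (g : G) : EllTwo G →ₗᵢ[ℂ] EllTwo G where
  toFun f := ⟨fun x => f (g⁻¹ * x), memℓp_leftTranslate g f⟩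
  map_add' _ _ := rfl
  map_smul' _ _ := rfl
  norm_map' f := by
    rw [lp.norm_eq_tsum_rpow (by norm_num), lp.norm_eq_tsum_rpow (by norm_num)]
    congr 1
    exact (Equiv.mulLeft g⁻¹).tsum_eq (fun x => ‖f x‖ ^ (2 : ℝ≥0∞).toReal)

/-- The left regular representation `λ` of `G` on `ℓ²(G)`, with values in the algebra of bounded
operators. -/
def leftRegular (G : Type*) [Group G] : G →* (EllTwo G →L[ℂ] EllTwo G) where
  toFun g := (leftTranslate g).toContinuousLinearMap
  map_one' := by
    ext f x
    change f (1⁻¹ * x) = f x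
    simp
  map_mul' g h := by
    ext f x
    change f ((g * h)⁻¹ * x) = f (h⁻¹ * (g⁻¹ * x))
    rw [mul_inv_rev, mul_assoc]

theorem leftRegular_apply (g : G) (f : EllTwo G) (x : G) :
    leftRegular G g f x = f (g⁻¹ * x) := rfl

end LeftRegular

/-- The reduced group `C*`-algebra of the discrete group `G`: the norm closure, inside the bounded
operators on `ℓ²(G)`, of the unital `*`-algebra generated by the left translation operators. -/
def reducedGroupCStarAlgebra (G : Type*) [Group G] :
    StarSubalgebra ℂ (EllTwo G →L[ℂ] EllTwo G) :=
  (StarAlgebra.adjoin ℂ (Set.range (leftRegular G))).topologicalClosure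

instance reducedGroupCStarAlgebra.instCStarAlgebra (G : Type*) [Group G] :
    CStarAlgebra (reducedGroupCStarAlgebra G) :=
  haveI : IsClosed (reducedGroupCStarAlgebra G : Set (EllTwo G →L[ℂ] EllTwo G)) :=
    StarSubalgebra.isClosed_topologicalClosure _
  StarSubalgebra.cstarAlgebra _

/-- A unital `C*`-algebra has stable rank one if its invertible elements are norm dense. -/
def HasStableRankOne (A : Type*) [CStarAlgebra A] : Prop :=
  Dense {a : A | IsUnit a}

end

/-! The distance from `T` to the invertibles is controlled by its 2-norm `‖T δ₁‖`. Approximate `T`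
by a finite sum `a` over `S` and replace `S` by a ping-pong translate `g S h`. The translated sum
preserves `ℓ²(Yᶜ)` and is there a multiple of an isometry, and so is its adjoint on `ℓ²(Y)`, with
factor the 2-norm. It is thus block triangular with small diagonal blocks, so subtracting it from
`1` leaves a unit (`isUnit_one_sub_sum_leftRegular`). Undoing the translation perturbs `a` by a
scalar multiple of a unitary to an invertible.

A functional-calculus argument (`hasStableRankOne_of_forall_norm_le_one`) reduces density to finding
an invertible within distance less than one of each contraction. If `b` or `b⋆` has 2-norm below
one, the estimate applies; otherwise `b` is unitary, because `δ₁` is separating.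

The translates come from `F₂` acting on `ℤ²` by shears: conjugating by a high power of `b` makes
every nontrivial element of a given finite set map `P` into the disjoint set `Q`. -/

/-! ### Block-triangular perturbations of the identity. -/

/-- A block-triangular perturbation criterion: an element whose two diagonal blocks, relative to an
idempotent `p` it preserves, are contractive differs from `1` by a unit. -/
theorem isUnit_one_sub_of_norm_mul_lt_one {R : Type*} [NormedRing R] [HasSummableGeomSeries R]
    {p u : R} (hup : u * p = p * u * p) (h₁ : ‖u * p‖ < 1)
    (h₂ : ‖(1 - p) * u‖ < 1) : IsUnit (1 - u) := by
  obtain ⟨v, hv⟩ := isUnit_one_sub_of_norm_lt_one h₁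
  have hq : (1 - p) * (v : R) = 1 - p := by
    rw [hv, mul_sub, mul_one, sub_mul 1 p (u * p), one_mul, ← mul_assoc, ← hup, sub_self, sub_zero]
  have hq' : (1 - p) * ((v⁻¹ : Rˣ) : R) = 1 - p := by
    rw [Units.mul_inv_eq_iff_eq_mul, hq]
  have hfac : 1 - u = v * (1 - ((v⁻¹ : Rˣ) * u) * (1 - p)) := by
    rw [mul_sub, mul_assoc, Units.mul_inv_cancel_left, mul_one, hv]
    noncomm_ring
  rw [hfac]
  refine v.isUnit.mul ?_
  -- With `q = 1 - p` and `y = v⁻¹ u`, `1 - y q` is a unit as soon as `1 - q y` is; and `q y = q u`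
  -- because `q v⁻¹ = q`.
  have h : IsUnit (1 - (1 - p) * ((v⁻¹ : Rˣ) * u)) := by
    rw [← mul_assoc, hq']
    exact isUnit_one_sub_of_norm_lt_one h₂
  obtain ⟨w, hw⟩ := h
  set y : R := (v⁻¹ : Rˣ) * u
  set q : R := 1 - p
  have e₁ : q * y * (w⁻¹ : Rˣ) = (w⁻¹ : Rˣ) - 1 := by
    have : (1 - q * y) * (w⁻¹ : Rˣ) = 1 := by rw [← hw, Units.mul_inv]
    rw [sub_mul, one_mul] at this
    rw [← this]; abel
  have e₂ : (w⁻¹ : Rˣ) * (q * y) = (w⁻¹ : Rˣ) - (1 : R) := by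
    have : (w⁻¹ : Rˣ) * (1 - q * y) = 1 := by rw [← hw, Units.inv_mul]
    rw [mul_sub, mul_one] at this
    rw [← this]; abel
  refine ⟨⟨1 - y * q, 1 + y * (w⁻¹ : Rˣ) * q, ?_, ?_⟩, rfl⟩
  · calc (1 - y * q) * (1 + y * (w⁻¹ : Rˣ) * q)
        = 1 - y * q + y * (w⁻¹ : Rˣ) * q - y * (q * y * (w⁻¹ : Rˣ)) * q := by noncomm_ring
      _ = 1 := by rw [e₁]; noncomm_ring
  · calc (1 + y * (w⁻¹ : Rˣ) * q) * (1 - y * q)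
        = 1 - y * q + y * (w⁻¹ : Rˣ) * q - y * ((w⁻¹ : Rˣ) * (q * y)) * q := by noncomm_ring
      _ = 1 := by rw [e₂]; noncomm_ring

/-! ### Reduction of density to the unit ball. -/

section CStar

variable {A : Type*} [CStarAlgebra A]

theorem spectrum_mul_star_self_nonneg {a : A} {s : ℝ} (hs : s ∈ spectrum ℝ (a * star a)) :
    0 ≤ s := by
  have := spectrum_star_mul_self_nonneg (b := star a)
  rw [star_star] at this
  exact this s hs

/-- The norm of `k(a a⋆) a` is controlled by the values of `k(s)² s`. -/
theorem norm_cfc_mul_self_le (a : A) {k : ℝ → ℝ} (hk : Continuous k) {r : ℝ} (hr : 0 ≤ r)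
    (h : ∀ s, 0 ≤ s → k s * s * k s ≤ r ^ 2) : ‖cfc k (a * star a) * a‖ ≤ r := by
  have hx : IsSelfAdjoint (a * star a) := .mul_star_self a
  refine abs_le_of_sq_le_sq' ?_ hr |>.2
  have hK : star (cfc k (a * star a)) = cfc k (a * star a) := cfc_predicate k (a * star a)
  have hprod : cfc k (a * star a) * a * star (cfc k (a * star a) * a)
      = cfc (fun s => k s * s * k s) (a * star a) := by
    rw [cfc_mul (fun s => k s * s) k (a * star a), cfc_mul k (fun s => s) (a * star a),
      cfc_id' ℝ (a * star a), star_mul, hK]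
    simp only [mul_assoc]
  rw [sq, ← CStarRing.norm_self_mul_star, hprod]
  refine norm_cfc_le (by positivity) fun s hs => ?_
  have hs0 := spectrum_mul_star_self_nonneg hs
  rw [Real.norm_of_nonneg (by nlinarith [mul_nonneg (mul_self_nonneg (k s)) hs0])]
  exact h s hs0

/-- If every element of the unit ball is at distance less than one from some invertible element,
then the invertible elements are dense. -/
theorem hasStableRankOne_of_forall_norm_le_one
    (H : ∀ b : A, ‖b‖ ≤ 1 → ∃ c, IsUnit c ∧ ‖b - c‖ < 1) : HasStableRankOne A := by
  refine Metric.dense_iff.2 fun a δ hδ => ?_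
  set α : ℝ := δ / 4 with hα
  have hα0 : 0 < α := by positivity
  set x : A := a * star a with hxdef
  have hx : IsSelfAdjoint x := .mul_star_self a
  -- `b = g(x) a` is a truncated polar part of `a`. The cutoff `e` vanishes for `√s ≤ α`, so `b b⋆ e
  -- = e`; it equals `1` for `√s ≥ 2α`, where `h` lives, so `e h = h`.
  obtain ⟨g, hg⟩ : ∃ g : ℝ → ℝ, ∀ s, g s = (max (√s) α)⁻¹ := ⟨_, fun _ => rfl⟩
  obtain ⟨e, he⟩ : ∃ e : ℝ → ℝ, ∀ s, e s = min 1 (max 0 ((√s - α) / α)) := ⟨_, fun _ => rfl⟩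
  obtain ⟨h, hh⟩ : ∃ h : ℝ → ℝ, ∀ s, h s = max (√s - 2 * α) 0 := ⟨_, fun _ => rfl⟩
  have hmax (s : ℝ) : 0 < max (√s) α := lt_max_of_lt_right hα0
  have hgc : Continuous g := by
    rw [funext hg]
    exact Continuous.inv₀ (by fun_prop) fun s => (hmax s).ne'
  have hec : Continuous e := by
    rw [funext he]
    fun_prop
  have hhc : Continuous h := by
    rw [funext hh]
    fun_prop
  set b : A := cfc g x * a with hb
  have hb1 : ‖b‖ ≤ 1 := by
    refine norm_cfc_mul_self_le a hgc zero_le_one fun s hs => ?_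
    have h1 : √s ≤ max (√s) α := le_max_left _ _
    have h2 : √s * √s = s := Real.mul_self_sqrt hs
    have h3 : g s * √s ≤ 1 := by
      rw [hg, inv_mul_le_iff₀ (hmax s)]; simp
    have h4 : 0 ≤ g s * √s := by rw [hg]; positivity
    calc g s * s * g s = (g s * √s) * (g s * √s) := by linear_combination -(g s * g s) * h2
      _ ≤ 1 ^ 2 := by nlinarith
  have hbb : b * star b * cfc e x = cfc e x := by
    have hK : star (cfc g x) = cfc g x := cfc_predicate g x
    have : b * star b * cfc e x = cfc (fun s => g s * s * g s * e s) x := by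
      rw [cfc_mul (fun s => g s * s * g s) e x, cfc_mul (fun s => g s * s) g x,
        cfc_mul g (fun s => s) x, cfc_id' ℝ x, hb, star_mul, hK, hxdef]
      simp only [mul_assoc]
    rw [this]
    refine cfc_congr fun s hs => ?_
    have hs0 := spectrum_mul_star_self_nonneg hs
    rcases le_total (√s) α with h1 | h1
    · have : (√s - α) / α ≤ 0 := div_nonpos_of_nonpos_of_nonneg (by linarith) hα0.le
      simp [he, max_eq_left this]
    · have h2 : √s * √s = s := Real.mul_self_sqrt hs0
      have h3 : √s ≠ 0 := (hα0.trans_le h1).ne'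
      have : g s * s * g s = 1 := by
        simp only [hg, max_eq_left h1]
        rw [← h2, Real.sqrt_mul_self (Real.sqrt_nonneg s)]
        field_simp
      simp only [this, one_mul]
  have heh : cfc e x * cfc h x = cfc h x := by
    rw [← cfc_mul e h x]
    refine cfc_congr fun s hs => ?_
    rcases le_total (√s) (2 * α) with h1 | h1
    · simp [hh, max_eq_right (sub_nonpos.2 h1)]
    · have : 1 ≤ (√s - α) / α := by rw [le_div_iff₀ hα0]; linarith
      have : e s = 1 := by
        rw [he]; rw [min_eq_left (this.trans (le_max_right _ _))]
      simp [this]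
  have hE1 : ‖cfc e x‖ ≤ 1 := by
    refine norm_cfc_le zero_le_one fun s _ => ?_
    rw [he, Real.norm_of_nonneg (le_min zero_le_one (le_max_left _ _))]
    exact min_le_left _ _
  obtain ⟨c, ⟨c, rfl⟩, hc⟩ := H b hb1
  -- `w = b⋆ e + c⁻¹ (1 - e)` is an invertible element with `w h = b⋆ h`
  have hw : IsUnit (star b * cfc e x + (c⁻¹ : Aˣ) * (1 - cfc e x)) := by
    -- Since `b b⋆ e = e`, the element in question is `c⁻¹ (1 - (b - c) b⋆ e)`.
    have hz : IsUnit (1 - (b - c) * (star b * cfc e x)) := by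
      refine isUnit_one_sub_of_norm_lt_one ?_
      calc ‖(b - c) * (star b * cfc e x)‖ ≤ ‖b - c‖ * (‖star b‖ * ‖cfc e x‖) :=
            (norm_mul_le _ _).trans (by gcongr; exact norm_mul_le _ _)
        _ ≤ ‖b - c‖ * (1 * 1) := by rw [norm_star]; gcongr
        _ < 1 := by simpa using hc
    convert (c⁻¹).isUnit.mul hz using 1
    rw [sub_mul, ← mul_assoc b, hbb, sub_sub_eq_add_sub, mul_sub _ (1 + _), mul_add,
      ← mul_assoc _ (c : A), Units.inv_mul]
    noncomm_ring
  set w : A := star b * cfc e x + (c⁻¹ : Aˣ) * (1 - cfc e x) with hwdef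
  have hwh : cfc h x * star w = cfc h x * b := by
    have h1 : w * cfc h x = star b * cfc h x := by
      rw [hwdef, add_mul, mul_assoc, mul_assoc, sub_mul, heh, one_mul, sub_self, mul_zero, add_zero]
    have hK : star (cfc h x) = cfc h x := cfc_predicate h x
    simpa [hK] using congrArg star h1
  have hw0 : 0 < ‖w‖ + 1 := by positivity
  -- Adding `ε` to `h ≥ 0` makes it invertible at a cost `ε ‖w‖ ≤ α`; with the error `2α` from
  -- truncation the total stays below `δ = 4α`.
  set ε : ℝ := α / (‖w‖ + 1) with hε
  have hε0 : 0 < ε := by positivity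
  have hHε : cfc (fun s => h s + ε) x = cfc h x + ε • (1 : A) := by
    rw [cfc_add x h (fun _ => ε), cfc_const ε x, Algebra.algebraMap_eq_smul_one]
  have hunit : IsUnit (cfc (fun s => h s + ε) x) := by
    rw [isUnit_cfc_iff _ x]
    intro s _
    have : 0 ≤ h s := by rw [hh]; exact le_max_right _ _
    positivity
  refine ⟨cfc (fun s => h s + ε) x * star w, ?_, hunit.mul hw.star⟩
  have hdiff : a - cfc (fun s => h s + ε) x * star w
      = cfc (fun s => 1 - h s * g s) x * a - ε • star w := by
    rw [hHε, add_mul, hwh, cfc_sub (fun _ => (1 : ℝ)) (fun s => h s * g s) x, cfc_const_one ℝ x,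
      cfc_mul h g x, hb, smul_mul_assoc, one_mul, sub_mul, one_mul, mul_assoc]
    abel
  have hk : ‖cfc (fun s => 1 - h s * g s) x * a‖ ≤ 2 * α := by
    refine norm_cfc_mul_self_le a (by fun_prop) (by positivity) fun s hs => ?_
    have h2 : √s * √s = s := Real.mul_self_sqrt hs
    have h0 := Real.sqrt_nonneg s
    rcases le_total (√s) (2 * α) with h1 | h1
    · simp only [hh, max_eq_right (sub_nonpos.2 h1)]
      nlinarith
    · have h3 : (1 - h s * g s) * √s = 2 * α := by
        simp only [hh, hg, max_eq_left (sub_nonneg.2 h1),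
          max_eq_left (show α ≤ √s by linarith)]
        have : √s ≠ 0 := by linarith
        field_simp
        ring
      calc (1 - h s * g s) * s * (1 - h s * g s)
          = ((1 - h s * g s) * √s) * ((1 - h s * g s) * √s) := by
            linear_combination -((1 - h s * g s) * (1 - h s * g s)) * h2
        _ ≤ (2 * α) ^ 2 := by rw [h3]; exact (sq _).ge
  rw [Metric.mem_ball, dist_comm, dist_eq_norm, hdiff]
  have hεw : ε * ‖w‖ ≤ α := by
    rw [hε, div_mul_eq_mul_div, div_le_iff₀ hw0]
    nlinarith
  calc _ ≤ 2 * α + ε * ‖w‖ := by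
        refine (norm_sub_le _ _).trans (add_le_add hk ?_)
        rw [norm_smul, norm_star, Real.norm_of_nonneg hε0.le]
    _ < δ := by rw [hα] at *; linarith

end CStar

/-! ### Translations on `ℓ²(G)` and ping-pong sums. -/

section Operators

variable {G : Type*}

/-- The closed subspace of functions in `ℓ²(G)` vanishing off `Z`. -/
def ellTwoOn (Z : Set G) : Submodule ℂ (EllTwo G) where
  carrier := {f | ∀ x ∉ Z, f x = 0}
  add_mem' hf hg x hx := by simp [hf x hx, hg x hx]
  zero_mem' _ _ := rfl
  smul_mem' c f hf x hx := by simp [hf x hx]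

theorem inner_eq_zero_of_forall {f k : EllTwo G} (h : ∀ x, f x = 0 ∨ k x = 0) :
    inner ℂ f k = 0 := by
  rw [lp.inner_eq_tsum]
  refine (tsum_congr fun x => ?_).trans tsum_zero
  rcases h x with h | h <;> simp [h]

open Classical in
/-- The point mass at `x`. -/
noncomputable def pointMass (x : G) : EllTwo G := lp.single 2 x (1 : ℂ)

theorem norm_pointMass (x : G) : ‖pointMass x‖ = 1 := by
  classical
  rw [pointMass, lp.norm_single (by norm_num)]
  simp

theorem inner_pointMass_left (x : G) (f : EllTwo G) : inner ℂ (pointMass x) f = f x := by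
  classical
  rw [pointMass, lp.inner_single_left]
  simp

theorem pointMass_mem_ellTwoOn {Z : Set G} {x : G} (hx : x ∈ Z) : pointMass x ∈ ellTwoOn Z := by
  classical
  intro y hy
  exact lp.single_apply_ne 2 x _ fun h => hy (h ▸ hx)

theorem orthogonal_ellTwoOn (Z : Set G) : (ellTwoOn Z)ᗮ = ellTwoOn Zᶜ := by
  ext f
  rw [Submodule.mem_orthogonal]
  constructor
  · intro h x hx
    rw [← inner_pointMass_left]
    exact h _ (pointMass_mem_ellTwoOn (not_not.1 hx))
  · intro h k hk
    refine inner_eq_zero_of_forall fun x => ?_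
    by_cases hx : x ∈ Z
    · exact Or.inr (h x (not_not.2 hx))
    · exact Or.inl (hk x hx)

instance (Z : Set G) : (ellTwoOn Z).HasOrthogonalProjection := by
  have : IsClosed (ellTwoOn Z : Set (EllTwo G)) := by
    have h := (ellTwoOn Zᶜ).isClosed_orthogonal
    rwa [orthogonal_ellTwoOn, compl_compl] at h
  have : CompleteSpace (ellTwoOn Z) := this.completeSpace_coe
  infer_instance

variable [Group G]

theorem norm_leftRegular_apply (g : G) (f : EllTwo G) : ‖leftRegular G g f‖ = ‖f‖ :=
  (leftTranslate g).norm_map f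

theorem star_leftRegular (g : G) : star (leftRegular G g) = leftRegular G g⁻¹ := by
  rw [ContinuousLinearMap.star_eq_adjoint, eq_comm, ContinuousLinearMap.eq_adjoint_iff]
  intro f k
  rw [lp.inner_eq_tsum, lp.inner_eq_tsum, ← (Equiv.mulLeft g⁻¹).tsum_eq]
  simp [leftRegular_apply]

theorem leftRegular_mem_ellTwoOn {Z W : Set G} {g : G} (h : ∀ x ∈ Z, g * x ∈ W) {f : EllTwo G}
    (hf : f ∈ ellTwoOn Z) : leftRegular G g f ∈ ellTwoOn W := by
  intro x hx
  rw [leftRegular_apply]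
  exact hf _ fun hx' => hx (by simpa using h _ hx')

theorem inner_leftRegular_eq_zero {Z : Set G} {g h : G}
    (hd : ∀ x ∈ Z, ∀ y ∈ Z, g * x ≠ h * y) {f k : EllTwo G} (hf : f ∈ ellTwoOn Z)
    (hk : k ∈ ellTwoOn Z) : inner ℂ (leftRegular G g f) (leftRegular G h k) = 0 := by
  refine inner_eq_zero_of_forall fun x => ?_
  rw [leftRegular_apply, leftRegular_apply]
  by_cases h₁ : g⁻¹ * x ∈ Z
  · by_cases h₂ : h⁻¹ * x ∈ Z
    · exact absurd (by simp) (hd _ h₁ _ h₂)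
    · exact Or.inr (hk _ h₂)
  · exact Or.inl (hf _ h₁)

/-- A combination of translations moving `Z` to disjoint sets is a multiple of an isometry on
`ℓ²(Z)`. -/
theorem norm_sq_sum_leftRegular {ι : Type*} (S : Finset ι) (c : ι → ℂ) (w : ι → G) {Z : Set G}
    (hd : ∀ i ∈ S, ∀ j ∈ S, i ≠ j → ∀ x ∈ Z, ∀ y ∈ Z, w i * x ≠ w j * y) {f : EllTwo G}
    (hf : f ∈ ellTwoOn Z) :
    ‖(∑ i ∈ S, c i • leftRegular G (w i)) f‖ ^ 2 = (∑ i ∈ S, ‖c i‖ ^ 2) * ‖f‖ ^ 2 := by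
  classical
  induction S using Finset.induction_on with
  | empty => simp
  | insert i S hi ih =>
    have ih' := ih fun i hi j hj =>
      hd i (Finset.mem_insert_of_mem hi) j (Finset.mem_insert_of_mem hj)
    have horth : inner ℂ ((c i • leftRegular G (w i)) f)
        ((∑ j ∈ S, c j • leftRegular G (w j)) f) = 0 := by
      rw [sum_apply, inner_sum]
      refine Finset.sum_eq_zero fun j hj => ?_
      rw [smul_apply, smul_apply, inner_smul_left, inner_smul_right,
        inner_leftRegular_eq_zero (hd i (Finset.mem_insert_self i S) j
          (Finset.mem_insert_of_mem hj) fun h => hi (h ▸ hj)) hf hf]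
      simp
    have hnorm : ‖(c i • leftRegular G (w i)) f‖ = ‖c i‖ * ‖f‖ := by
      rw [smul_apply, norm_smul, norm_leftRegular_apply]
    rw [Finset.sum_insert hi, Finset.sum_insert hi, add_apply, add_mul, ← ih', sq,
      norm_add_sq_eq_norm_sq_add_norm_sq_of_inner_eq_zero _ _ horth, hnorm]
    ring

theorem norm_mul_starProjection_lt_one {E : Type*} [NormedAddCommGroup E] [InnerProductSpace ℂ E]
    (K : Submodule ℂ E) [K.HasOrthogonalProjection] (u : E →L[ℂ] E) {r : ℝ} (hr : r < 1)
    (h : ∀ f ∈ K, ‖u f‖ ^ 2 = r * ‖f‖ ^ 2) : ‖u * K.starProjection‖ < 1 := by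
  rcases lt_or_ge r 0 with hr0 | hr0
  · have hK : K.starProjection = 0 := by
      ext f
      have h₁ := h _ (K.starProjection_apply_mem f)
      have h₂ : ‖K.starProjection f‖ ^ 2 = 0 := by
        nlinarith [sq_nonneg ‖u (K.starProjection f)‖, sq_nonneg ‖K.starProjection f‖]
      simpa using h₂
    simp [hK]
  · refine lt_of_le_of_lt (ContinuousLinearMap.opNorm_le_bound _ (Real.sqrt_nonneg r) fun f => ?_)
      ((Real.sqrt_lt' one_pos).2 (by simpa using hr))
    refine abs_le_of_sq_le_sq' ?_ (by positivity) |>.2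
    rw [mul_apply_eq_comp, h _ (K.starProjection_apply_mem f), mul_pow,
      Real.sq_sqrt hr0]
    gcongr
    exact (K.starProjection.le_opNorm f).trans
      (mul_le_of_le_one_left (norm_nonneg f) K.starProjection_norm_le)

/-- A combination of translations with ping-pong dynamics relative to `Y` has spectral radius at
most its `2`-norm. -/
theorem isUnit_one_sub_sum_leftRegular {ι : Type*} (S : Finset ι) (c : ι → ℂ) (w : ι → G)
    {Y : Set G} (hinv : ∀ i ∈ S, ∀ x ∉ Y, w i * x ∉ Y)
    (hd : ∀ i ∈ S, ∀ j ∈ S, i ≠ j → ∀ x ∉ Y, ∀ y ∉ Y, w i * x ≠ w j * y)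
    (hd' : ∀ i ∈ S, ∀ j ∈ S, i ≠ j → ∀ x ∈ Y, ∀ y ∈ Y, (w i)⁻¹ * x ≠ (w j)⁻¹ * y)
    (hc : ∑ i ∈ S, ‖c i‖ ^ 2 < 1) : IsUnit (1 - ∑ i ∈ S, c i • leftRegular G (w i)) := by
  set u := ∑ i ∈ S, c i • leftRegular G (w i) with hu
  have hstar : star u = ∑ i ∈ S, star (c i) • leftRegular G (w i)⁻¹ := by
    simp only [hu, star_sum, star_smul, star_leftRegular]
  refine isUnit_one_sub_of_norm_mul_lt_one (p := (ellTwoOn Yᶜ).starProjection) ?_ ?_ ?_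
  · ext1 f
    simp only [mul_apply_eq_comp]
    refine (Submodule.starProjection_eq_self_iff.2 ?_).symm
    rw [hu, sum_apply]
    refine Submodule.sum_mem _ fun i hi => Submodule.smul_mem _ _ ?_
    exact leftRegular_mem_ellTwoOn (Z := Yᶜ) (W := Yᶜ) (hinv i hi)
      (Submodule.starProjection_apply_mem _ f)
  · exact norm_mul_starProjection_lt_one (ellTwoOn Yᶜ) u hc fun f hf =>
      norm_sq_sum_leftRegular S c w (Z := Yᶜ) hd hf
  -- The other diagonal block is estimated through its adjoint, a sum of inverse translations
  -- restricted to `ℓ²(Y)`.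
  · have hq : 1 - (ellTwoOn Yᶜ).starProjection = (ellTwoOn Y).starProjection := by
      have h : (ellTwoOn Yᶜ)ᗮ = ellTwoOn Y := by rw [orthogonal_ellTwoOn, compl_compl]
      simp only [← Submodule.starProjection_orthogonal', h]
    rw [hq, ← norm_star, star_mul, (isSelfAdjoint_starProjection (ellTwoOn Y)).star_eq, hstar]
    refine norm_mul_starProjection_lt_one _ _ hc fun f hf => ?_
    rw [norm_sq_sum_leftRegular S (fun i => star (c i)) (fun i => (w i)⁻¹) hd' hf]
    simp

end Operators

/-! ### The reduced algebra and its 2-norm. -/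

section Reduced

variable {G : Type*} [Group G]

theorem leftRegular_mem_reducedGroupCStarAlgebra (g : G) :
    leftRegular G g ∈ reducedGroupCStarAlgebra G :=
  StarSubalgebra.le_topologicalClosure _ (StarAlgebra.subset_adjoin ℂ _ ⟨g, rfl⟩)

/-- The translations form a submonoid closed under `star`, so the `*`-algebra they generate is just
their linear span. -/
theorem exists_sum_leftRegular_eq_of_mem_adjoin {T : EllTwo G →L[ℂ] EllTwo G}
    (hT : T ∈ StarAlgebra.adjoin ℂ (Set.range (leftRegular G))) :
    ∃ (S : Finset G) (c : G → ℂ), T = ∑ s ∈ S, c s • leftRegular G s := by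
  have hrange : Set.range (leftRegular G) ∪ star (Set.range (leftRegular G))
      = Set.range (leftRegular G) := by
    refine Set.union_eq_left.2 ?_
    rintro T ⟨g, hg⟩
    exact ⟨g⁻¹, by rw [← star_leftRegular, hg, star_star]⟩
  have hspan : T ∈ Submodule.span ℂ (Set.range (leftRegular G)) := by
    have h : T ∈ Subalgebra.toSubmodule
        (StarAlgebra.adjoin ℂ (Set.range (leftRegular G))).toSubalgebra := hT
    rw [StarAlgebra.adjoin_eq_span, hrange] at h
    have hcl : (Submonoid.closure (Set.range (leftRegular G)) : Set (EllTwo G →L[ℂ] EllTwo G))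
        = Set.range (leftRegular G) := by
      rw [← MonoidHom.coe_mrange, Submonoid.closure_eq]
    rwa [hcl] at h
  obtain ⟨c, rfl⟩ := Finsupp.mem_span_range_iff_exists_finsupp.1 hspan
  exact ⟨c.support, c, rfl⟩

theorem exists_norm_sub_sum_leftRegular_lt {T : EllTwo G →L[ℂ] EllTwo G}
    (hT : T ∈ reducedGroupCStarAlgebra G) {ε : ℝ} (hε : 0 < ε) :
    ∃ (S : Finset G) (c : G → ℂ), ‖T - ∑ s ∈ S, c s • leftRegular G s‖ < ε := by
  obtain ⟨T', hT', h⟩ := Metric.mem_closure_iff.1 hT ε hε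
  obtain ⟨S, c, rfl⟩ := exists_sum_leftRegular_eq_of_mem_adjoin hT'
  exact ⟨S, c, by rwa [← dist_eq_norm]⟩

open Classical in
/-- Elements of the reduced `C*`-algebra commute with right translations. -/
theorem apply_pointMass_of_mem {T : EllTwo G →L[ℂ] EllTwo G}
    (hT : T ∈ reducedGroupCStarAlgebra G) (g x : G) :
    T (pointMass g) x = T (pointMass 1) (x * g⁻¹) := by
  have heval (f : EllTwo G) (x : G) : Continuous fun T : EllTwo G →L[ℂ] EllTwo G => T f x := by
    simp_rw [← inner_pointMass_left]
    fun_prop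
  have hclosed : IsClosed {T : EllTwo G →L[ℂ] EllTwo G |
      T (pointMass g) x = T (pointMass 1) (x * g⁻¹)} :=
    isClosed_eq (heval _ _) (heval _ _)
  refine closure_minimal (fun T hT => ?_) hclosed hT
  obtain ⟨S, c, rfl⟩ := exists_sum_leftRegular_eq_of_mem_adjoin hT
  have h (y g : G) : pointMass g y = if y = g then (1 : ℂ) else 0 := by
    rw [pointMass, lp.single_apply, Pi.single_apply]
  simp only [Set.mem_ofPred_eq, sum_apply, smul_apply, lp.coeFn_sum, Finset.sum_apply,
    lp.coeFn_smul, Pi.smul_apply, leftRegular_apply, h]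
  refine Finset.sum_congr rfl fun s _ => ?_
  simp only [← mul_assoc, mul_inv_eq_one]

/-- Commutation with right translations carries the fixed vector `δ₁` to every `δ_g`;
self-adjointness then recovers each coordinate of `T f`. -/
theorem eq_one_of_apply_pointMass_one {T : EllTwo G →L[ℂ] EllTwo G} (hsa : star T = T)
    (hT : T ∈ reducedGroupCStarAlgebra G) (h : T (pointMass 1) = pointMass 1) : T = 1 := by
  have hg (g : G) : T (pointMass g) = pointMass g := by
    ext x
    rw [apply_pointMass_of_mem hT, h]
    exact (apply_pointMass_of_mem (one_mem (reducedGroupCStarAlgebra G)) g x).symm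
  ext f x
  rw [one_apply_eq_self, ← inner_pointMass_left x (T f), ← hsa,
    ContinuousLinearMap.star_eq_adjoint, ContinuousLinearMap.adjoint_inner_right, hg,
    inner_pointMass_left]

/-- Equality case of Cauchy–Schwarz: `⟨T⋆T f, f⟩ = ‖T f‖² ≥ 1` while both vectors have norm at most
one. -/
theorem adjoint_apply_apply_eq_self {E : Type*} [NormedAddCommGroup E] [InnerProductSpace ℂ E]
    [CompleteSpace E] {T : E →L[ℂ] E} {f : E} (hT : ‖T‖ ≤ 1) (hf : ‖f‖ = 1) (h : 1 ≤ ‖T f‖) :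
    ContinuousLinearMap.adjoint T (T f) = f := by
  have hTf : ‖T f‖ ≤ 1 := (T.le_of_opNorm_le hT f).trans (by rw [hf, mul_one])
  have hle : ‖ContinuousLinearMap.adjoint T (T f)‖ ≤ 1 := by
    refine ((ContinuousLinearMap.adjoint T).le_of_opNorm_le (c := 1) ?_ _).trans (by simpa)
    rwa [LinearIsometryEquiv.norm_map]
  have hin : RCLike.re (inner ℂ (ContinuousLinearMap.adjoint T (T f)) f) = ‖T f‖ ^ 2 := by
    rw [ContinuousLinearMap.adjoint_inner_left, inner_self_eq_norm_sq]
  have hsub := norm_sub_sq (𝕜 := ℂ) (ContinuousLinearMap.adjoint T (T f)) f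
  rw [hin, hf] at hsub
  have : ‖ContinuousLinearMap.adjoint T (T f) - f‖ ^ 2 ≤ 0 := by
    nlinarith [norm_nonneg (ContinuousLinearMap.adjoint T (T f))]
  rw [← sub_eq_zero, ← norm_eq_zero]
  exact pow_eq_zero_iff two_ne_zero |>.1 (le_antisymm this (sq_nonneg _))

/-- A contraction of the reduced `C*`-algebra of `2`-norm at least one is an isometry. -/
theorem star_mul_self_eq_one_of_norm_le_one {T : EllTwo G →L[ℂ] EllTwo G}
    (hT : T ∈ reducedGroupCStarAlgebra G) (h₁ : ‖T‖ ≤ 1) (h₂ : 1 ≤ ‖T (pointMass 1)‖) :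
    star T * T = 1 := by
  have hmem : star T * T ∈ reducedGroupCStarAlgebra G := mul_mem (star_mem hT) hT
  have hsa : star (star T * T) = star T * T := by rw [star_mul, star_star]
  have hfix : ContinuousLinearMap.adjoint T (T (pointMass 1)) = pointMass 1 :=
    adjoint_apply_apply_eq_self h₁ (norm_pointMass 1) h₂
  have hfix' : (star T * T) (pointMass 1) = pointMass 1 := by
    rw [mul_apply_eq_comp]
    exact hfix
  exact eq_one_of_apply_pointMass_one hsa hmem hfix'

variable (G) in
/-- Every finite subset of `G` admits a two-sided translate `g S h` playing ping-pong on `G`: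
its elements map the complement of a set `Y` to pairwise disjoint subsets of it, and their inverses
map `Y` to pairwise disjoint sets. -/
def HasPingPongTranslates : Prop :=
  ∀ S : Finset G, ∃ (g h : G) (Y : Set G),
    (∀ s ∈ S, ∀ x ∉ Y, g * s * h * x ∉ Y) ∧
    (∀ s ∈ S, ∀ t ∈ S, s ≠ t → ∀ x ∉ Y, ∀ y ∉ Y, g * s * h * x ≠ g * t * h * y) ∧
    (∀ s ∈ S, ∀ t ∈ S, s ≠ t → ∀ x ∈ Y, ∀ y ∈ Y, (g * s * h)⁻¹ * x ≠ (g * t * h)⁻¹ * y)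

/-- The distance from an element to the invertible operators in the reduced `C*`-algebra is
dominated by its `2`-norm. -/
theorem HasPingPongTranslates.exists_isUnit_norm_sub_lt_one (hG : HasPingPongTranslates G)
    {T : EllTwo G →L[ℂ] EllTwo G} (hT : T ∈ reducedGroupCStarAlgebra G)
    (h : ‖T (pointMass 1)‖ < 1) :
    ∃ C ∈ reducedGroupCStarAlgebra G, IsUnit C ∧ ‖T - C‖ < 1 := by
  -- Here `‖T δ₁‖ = 1 - 3ε`, so an `ε`-approximant has 2-norm below `r = 1 - ε`; moving it by a
  -- unitary times `r` still ends at distance less than `ε + r = 1` from `T`.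
  set ε : ℝ := (1 - ‖T (pointMass 1)‖) / 3 with hε
  have hε0 : 0 < ε := by rw [hε]; linarith
  have hr0 : 0 < 1 - ε := by rw [hε]; linarith [norm_nonneg (T (pointMass 1))]
  obtain ⟨S, c, hSc⟩ := exists_norm_sub_sum_leftRegular_lt hT hε0
  set a := ∑ s ∈ S, c s • leftRegular G s with ha
  have hc : ∑ s ∈ S, ‖c s‖ ^ 2 < (1 - ε) ^ 2 := by
    -- Distinct elements of `S` move the singleton `{1}` to disjoint sets, so `‖a δ₁‖² = ∑ |c s|²`.
    have h₁ := norm_sq_sum_leftRegular S c (fun s => s) (Z := {(1 : G)})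
      (fun i _ j _ hij x hx y hy => by
        rw [Set.mem_singleton_iff] at hx hy
        simpa [hx, hy] using hij) (pointMass_mem_ellTwoOn (Set.mem_singleton 1))
    rw [norm_pointMass, one_pow, mul_one] at h₁
    rw [← h₁]
    have h₂ : ‖(T - a) (pointMass 1)‖ < ε := by
      refine lt_of_le_of_lt ((T - a).le_opNorm _) ?_
      rwa [norm_pointMass, mul_one]
    rw [sub_apply] at h₂
    have h₃ : ‖a (pointMass 1)‖ < 1 - ε := by
      have := norm_sub_norm_le (a (pointMass 1)) (T (pointMass 1))
      rw [norm_sub_rev] at this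
      linarith
    gcongr
  obtain ⟨g, k, Y, hinv, hd, hd'⟩ := hG S
  set r : ℂ := ((1 - ε : ℝ) : ℂ) with hr
  have hrn : ‖r‖ = 1 - ε := by rw [hr, Complex.norm_real, Real.norm_of_nonneg hr0.le]
  have hrne : r ≠ 0 := by rw [← norm_pos_iff, hrn]; exact hr0
  have hunit := isUnit_one_sub_sum_leftRegular S (fun s => r⁻¹ * c s) (fun s => g * s * k)
    hinv hd hd' (by
      simp only [norm_mul, norm_inv, hrn, mul_pow]
      rw [← Finset.mul_sum, inv_pow, inv_mul_lt_iff₀ (by positivity), mul_one]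
      exact hc)
  have hsum : ∑ s ∈ S, (r⁻¹ * c s) • leftRegular G (g * s * k)
      = r⁻¹ • (leftRegular G g * a * leftRegular G k) := by
    simp only [ha, Finset.mul_sum, Finset.sum_mul, Finset.smul_sum, map_mul, mul_smul_comm,
      smul_mul_assoc, smul_smul]
  have hinvl (x : G) : leftRegular G x⁻¹ * leftRegular G x = 1 := by
    rw [← map_mul, inv_mul_cancel, map_one]
  have hinvr (x : G) : leftRegular G x * leftRegular G x⁻¹ = 1 := by
    rw [← map_mul, mul_inv_cancel, map_one]
  have hfac : a - r • leftRegular G (g⁻¹ * k⁻¹) = (-r) • (leftRegular G g⁻¹ *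
      (1 - r⁻¹ • (leftRegular G g * a * leftRegular G k)) * leftRegular G k⁻¹) := by
    have h₁ : leftRegular G g⁻¹ * (leftRegular G g * a * leftRegular G k) * leftRegular G k⁻¹
        = a := by
      rw [mul_assoc, mul_assoc (_ * a), hinvr, mul_one, ← mul_assoc, hinvl, one_mul]
    rw [mul_sub, sub_mul, mul_one, mul_smul_comm, smul_mul_assoc, h₁, smul_sub, smul_smul,
      neg_mul, mul_inv_cancel₀ hrne, map_mul]
    module
  refine ⟨a - r • leftRegular G (g⁻¹ * k⁻¹), ?_, ?_, ?_⟩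
  · refine sub_mem (sum_mem fun s _ => ?_) ?_
    · exact SMulMemClass.smul_mem _ (leftRegular_mem_reducedGroupCStarAlgebra s)
    · exact SMulMemClass.smul_mem _ (leftRegular_mem_reducedGroupCStarAlgebra _)
  · rw [hfac, ← hsum]
    have hu (x : G) : IsUnit (leftRegular G x) := (Group.isUnit x).map (leftRegular G)
    have := ((hu g⁻¹).mul hunit).mul (hu k⁻¹)
    exact this.smul (Units.mk0 (-r) (neg_ne_zero.2 hrne))
  · have hn : ‖r • leftRegular G (g⁻¹ * k⁻¹)‖ ≤ 1 - ε := by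
      rw [norm_smul, hrn]
      refine mul_le_of_le_one_right hr0.le ?_
      exact (leftTranslate (g⁻¹ * k⁻¹)).norm_toContinuousLinearMap_le
    rw [← sub_add]
    refine (norm_add_le _ _).trans_lt ?_
    linarith

theorem HasPingPongTranslates.hasStableRankOne (hG : HasPingPongTranslates G) :
    HasStableRankOne (reducedGroupCStarAlgebra G) := by
  have hclosed : IsClosed (reducedGroupCStarAlgebra G : Set (EllTwo G →L[ℂ] EllTwo G)) :=
    StarSubalgebra.isClosed_topologicalClosure _
  have key (b : reducedGroupCStarAlgebra G)
      (hb : ‖(b : EllTwo G →L[ℂ] EllTwo G) (pointMass 1)‖ < 1) : ∃ c, IsUnit c ∧ ‖b - c‖ < 1 := by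
    obtain ⟨C, hC, hu, hlt⟩ := hG.exists_isUnit_norm_sub_lt_one b.2 hb
    refine ⟨⟨C, hC⟩, ?_, hlt⟩
    exact (StarSubalgebra.coe_isUnit (S := reducedGroupCStarAlgebra G) (a := ⟨C, hC⟩)).1 hu
  refine hasStableRankOne_of_forall_norm_le_one fun b hb => ?_
  by_cases h₁ : ‖(b : EllTwo G →L[ℂ] EllTwo G) (pointMass 1)‖ < 1
  · exact key b h₁
  by_cases h₂ : ‖(star b : reducedGroupCStarAlgebra G).1 (pointMass 1)‖ < 1
  · obtain ⟨c, hc, hlt⟩ := key (star b) h₂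
    refine ⟨star c, hc.star, ?_⟩
    rwa [← norm_star, star_sub, star_star]
  have hb' : ‖(star b : reducedGroupCStarAlgebra G)‖ ≤ 1 := by rwa [norm_star]
  have e₁ := star_mul_self_eq_one_of_norm_le_one b.2 hb (not_lt.1 h₁)
  have e₂ := star_mul_self_eq_one_of_norm_le_one (star b).2 hb' (not_lt.1 h₂)
  refine ⟨b, ⟨⟨b, star b, Subtype.ext ?_, Subtype.ext e₁⟩, rfl⟩, by simp⟩
  simpa using e₂

end Reduced

/-! ### Ping-pong dynamics and translates of finite sets. -/

section PingPong

variable {G X : Type*} [Group G] [MulAction G X]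

/-- Alternating words `a^n₁ b^m₁ ⋯ b^mₖ a^nₖ₊₁` with nonzero exponents, beginning and ending with a
power of `a`. -/
inductive IsAlternating (a b : G) : G → Prop
  | single (n : ℤ) (hn : n ≠ 0) : IsAlternating a b (a ^ n)
  | cons (n m : ℤ) (hn : n ≠ 0) (hm : m ≠ 0) (t : G) (ht : IsAlternating a b t) :
      IsAlternating a b (a ^ n * (b ^ m * t))

/-- The normal forms of elements of a group generated by `a` and `b`. -/
def IsNormalForm (a b t : G) : Prop :=
  (∃ i : ℤ, t = b ^ i) ∨ ∃ (i k : ℤ) (u : G), IsAlternating a b u ∧ t = b ^ i * (u * b ^ k)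

theorem IsNormalForm.zpow_right_mul {a b t : G} (ht : IsNormalForm a b t) (n : ℤ) :
    IsNormalForm a b (b ^ n * t) := by
  rcases ht with ⟨i, rfl⟩ | ⟨i, k, u, hu, rfl⟩
  · exact Or.inl ⟨n + i, (zpow_add b n i).symm⟩
  · exact Or.inr ⟨n + i, k, u, hu, by rw [zpow_add, mul_assoc]⟩

theorem IsNormalForm.zpow_left_mul {a b t : G} (ht : IsNormalForm a b t) (n : ℤ) :
    IsNormalForm a b (a ^ n * t) := by
  rcases eq_or_ne n 0 with rfl | hn
  · simpa using ht
  rcases ht with ⟨i, rfl⟩ | ⟨i, k, u, hu, rfl⟩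
  · exact Or.inr ⟨0, i, a ^ n, .single n hn, by simp⟩
  rcases ne_or_eq i 0 with hi | rfl
  · exact Or.inr ⟨0, k, _, .cons n i hn hi u hu, by simp [mul_assoc]⟩
  rw [zpow_zero, one_mul]
  cases hu with
  | single m hm =>
    rw [← mul_assoc, ← zpow_add]
    rcases eq_or_ne (n + m) 0 with h | h
    · exact Or.inl ⟨k, by simp [h]⟩
    · exact Or.inr ⟨0, k, _, .single (n + m) h, by simp⟩
  | cons m l hm hl u hu =>
    rw [mul_assoc, ← mul_assoc, ← zpow_add]
    rcases eq_or_ne (n + m) 0 with h | h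
    · exact Or.inr ⟨l, k, u, hu, by simp [h, mul_assoc]⟩
    · exact Or.inr ⟨0, k, _, .cons (n + m) l h hl u hu, by simp [mul_assoc]⟩

theorem isNormalForm_freeGroup (t : FreeGroup (Fin 2)) :
    IsNormalForm (FreeGroup.of 0) (FreeGroup.of 1) t := by
  have h1 : ∀ (i : Fin 2) (n : ℤ) (t : FreeGroup (Fin 2)),
      IsNormalForm (FreeGroup.of 0) (FreeGroup.of 1) t →
      IsNormalForm (FreeGroup.of 0) (FreeGroup.of 1) (FreeGroup.of i ^ n * t) := by
    intro i n t ht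
    fin_cases i
    · exact ht.zpow_left_mul n
    · exact ht.zpow_right_mul n
  suffices ∀ s t : FreeGroup (Fin 2), IsNormalForm (FreeGroup.of 0) (FreeGroup.of 1) t →
      IsNormalForm (FreeGroup.of 0) (FreeGroup.of 1) (s * t) by
    simpa using this t 1 (Or.inl ⟨0, by simp⟩)
  intro s
  induction s using FreeGroup.induction_on with
  | C1 => intro t ht; rwa [one_mul]
  | of i => intro t ht; simpa using h1 i 1 t ht
  | inv_of i _ => intro t ht; simpa using h1 i (-1) t ht
  | mul x y hx hy => intro t ht; rw [mul_assoc]; exact hx _ (hy t ht)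

theorem IsAlternating.smul_mem {a b u : G} {P Q : Set X}
    (ha : ∀ n : ℤ, n ≠ 0 → ∀ x ∈ Q, a ^ n • x ∈ P) (hb : ∀ n : ℤ, n ≠ 0 → ∀ x ∈ P, b ^ n • x ∈ Q)
    (hu : IsAlternating a b u) {x : X} (hx : x ∈ Q) : u • x ∈ P := by
  induction hu with
  | single n hn => exact ha n hn x hx
  | cons n m hn hm t _ ih =>
    rw [mul_smul, mul_smul]
    exact ha n hn _ (hb m hm _ ih)

/-- In a ping-pong situation, conjugation by high powers of `b` takes every nontrivial element to
one that maps `P` to `Q`. -/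
theorem IsNormalForm.eventually_smul_mem {a b t : G} {P Q : Set X}
    (ha : ∀ n : ℤ, n ≠ 0 → ∀ x ∈ Q, a ^ n • x ∈ P) (hb : ∀ n : ℤ, n ≠ 0 → ∀ x ∈ P, b ^ n • x ∈ Q)
    (ht : IsNormalForm a b t) (h1 : t ≠ 1) :
    ∀ᶠ N : ℤ in Filter.atTop, ∀ x ∈ P, (b ^ (-N) * t * b ^ N) • x ∈ Q := by
  rcases ht with ⟨i, rfl⟩ | ⟨i, k, u, hu, rfl⟩
  · refine Filter.Eventually.of_forall fun N x hx => ?_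
    rw [← zpow_add, ← zpow_add]
    refine hb _ (fun h => h1 ?_) x hx
    rw [show i = 0 by omega, zpow_zero]
  -- Conjugation gives `b^(i-N) u b^(k+N)` with both outer exponents nonzero, so the three factors
  -- send `P → Q → P → Q`.
  · filter_upwards [Filter.eventually_gt_atTop i, Filter.eventually_gt_atTop (-k)] with N hi hk x hx
    have : b ^ (-N) * (b ^ i * (u * b ^ k)) * b ^ N = b ^ (i - N) * (u * b ^ (k + N)) := by
      rw [sub_eq_neg_add, zpow_add, zpow_add]
      simp only [mul_assoc]
    rw [this, mul_smul, mul_smul]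
    exact hb _ (by omega) _ (hu.smul_mem ha hb (hb _ (by omega) x hx))

open scoped Pointwise in
/-- A ping-pong pair generating `G`, together with a suitable half `Y` of the set `P`, yields
ping-pong translates of all finite subsets. -/
theorem hasPingPongTranslates_of_isNormalForm {a b : G} (hgen : ∀ t, IsNormalForm a b t)
    {P Q Y : Set X} (hPQ : Disjoint P Q)
    (ha : ∀ n : ℤ, n ≠ 0 → ∀ x ∈ Q, a ^ n • x ∈ P) (hb : ∀ n : ℤ, n ≠ 0 → ∀ x ∈ P, b ^ n • x ∈ Q)
    (hY : Y ⊆ P) {x₀ : X} (haY : ∀ x ∈ MulAction.orbit G x₀, x ∉ Y → a • x ∈ P \ Y) :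
    HasPingPongTranslates G := by
  classical
  intro S
  -- `S` serves the invariance of `Yᶜ`, `S⁻¹ S` the disjointness of the images, and `S S⁻¹` that of
  -- the inverse images.
  have hev : ∀ᶠ N : ℤ in Filter.atTop, ∀ t ∈ (S ∪ S * S⁻¹) ∪ S⁻¹ * S, t ≠ 1 →
      ∀ x ∈ P, (b ^ (-N) * t * b ^ N) • x ∈ Q := by
    rw [Filter.eventually_all_finset]
    intro t _
    by_cases h1 : t = 1
    · exact Filter.Eventually.of_forall fun N h => absurd h1 h
    · filter_upwards [(hgen t).eventually_smul_mem ha hb h1] with N hN _ using hN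
  obtain ⟨N, hN⟩ := hev.exists
  have key (t : G) (ht : t ∈ (S ∪ S * S⁻¹) ∪ S⁻¹ * S) (h1 : t ≠ 1) (x : X) (hx : x ∈ P) :
      (b ^ (-N) * t * b ^ N) • x ∉ P :=
    fun h => Set.disjoint_left.1 hPQ h (hN t ht h1 x hx)
  -- The extra `a` first pushes orbit points outside `Y` into `P \ Y`, where the conjugates act; it
  -- also handles `s = 1`, which the conjugation leaves trivial.
  refine ⟨b ^ (-N), b ^ N * a, {g | g • x₀ ∈ Y}, ?_, ?_, ?_⟩
  · intro s hs x hx hxY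
    have h := haY _ ⟨x, rfl⟩ hx
    have he : (b ^ (-N) * s * (b ^ N * a) * x) • x₀ = (b ^ (-N) * s * b ^ N) • a • x • x₀ := by
      simp only [mul_smul]
    rw [Set.mem_ofPred_eq, he] at hxY
    by_cases h1 : s = 1
    · subst h1
      rw [mul_one, ← zpow_add, neg_add_cancel, zpow_zero, one_smul] at hxY
      exact h.2 hxY
    · exact key s (by simp [hs]) h1 _ h.1 (hY hxY)
  · intro s hs t ht hst x hx y hy hxy
    have h : (t⁻¹ * s) ≠ 1 := fun h => hst (inv_mul_eq_one.1 h).symm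
    refine key (t⁻¹ * s) ?_ h _ (haY _ ⟨x, rfl⟩ hx).1 ?_
    · exact Finset.mem_union_right _ (Finset.mul_mem_mul (Finset.inv_mem_inv ht) hs)
    · have he : b ^ (-N) * (t⁻¹ * s) * b ^ N * (a * x) = a * y := by
        have := congrArg (fun z => a * (b ^ (-N) * t * (b ^ N * a))⁻¹ * z) hxy
        simp only [mul_inv_rev, zpow_neg, inv_inv, mul_assoc, mul_inv_cancel_left,
          inv_mul_cancel_left] at this ⊢
        exact this
      have h2 := (haY _ ⟨y, rfl⟩ hy).1
      rw [← mul_smul, ← he, mul_smul, mul_smul a x] at h2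
      exact h2
  · intro s hs t ht hst x hx y hy hxy
    have h : (t * s⁻¹) ≠ 1 := fun h => hst (mul_inv_eq_one.1 h).symm
    refine key (t * s⁻¹) ?_ h _ (hY hx) ?_
    · exact Finset.mem_union_left _ (Finset.mem_union_right _
        (Finset.mul_mem_mul ht (Finset.inv_mem_inv hs)))
    · have he : b ^ (-N) * (t * s⁻¹) * b ^ N * x = y := by
        have := congrArg (fun z => b ^ (-N) * t * (b ^ N * a) * z) hxy
        simp only [mul_inv_rev, zpow_neg, inv_inv, mul_assoc, mul_inv_cancel_left,
          inv_mul_cancel_left] at this ⊢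
        exact this
      rw [← mul_smul, he]
      exact hY hy

end PingPong

/-! ### The free group acting on `ℤ²` by shears. -/

/-- The shear `(x, y) ↦ (x + 3 y, y)` of `ℤ²`. -/
def upperShear : (ℤ × ℤ) ≃ₗ[ℤ] (ℤ × ℤ) where
  toFun v := (v.1 + 3 * v.2, v.2)
  invFun v := (v.1 - 3 * v.2, v.2)
  left_inv v := by simp
  right_inv v := by simp
  map_add' v w := by ext <;> simp; ring
  map_smul' c v := by ext <;> simp; ring

/-- The shear `(x, y) ↦ (x, y + 3 x)` of `ℤ²`. -/
def lowerShear : (ℤ × ℤ) ≃ₗ[ℤ] (ℤ × ℤ) where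
  toFun v := (v.1, v.2 + 3 * v.1)
  invFun v := (v.1, v.2 - 3 * v.1)
  left_inv v := by simp
  right_inv v := by simp
  map_add' v w := by ext <;> simp; ring
  map_smul' c v := by ext <;> simp; ring

theorem upperShear_zpow_apply (n : ℤ) (v : ℤ × ℤ) :
    (upperShear ^ n) v = (v.1 + 3 * n * v.2, v.2) := by
  induction n using Int.induction_on with
  | zero => simp
  | succ n ih =>
    rw [add_comm, zpow_add, LinearEquiv.mul_apply, ih, zpow_one]
    change (_ + _, _) = _
    ext <;> simp; ring
  | pred n ih =>
    rw [sub_eq_neg_add, zpow_add, LinearEquiv.mul_apply, ih, zpow_neg_one]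
    change (_ - _, _) = _
    ext <;> simp; ring

theorem lowerShear_zpow_apply (n : ℤ) (v : ℤ × ℤ) :
    (lowerShear ^ n) v = (v.1, v.2 + 3 * n * v.1) := by
  induction n using Int.induction_on with
  | zero => simp
  | succ n ih =>
    rw [add_comm, zpow_add, LinearEquiv.mul_apply, ih, zpow_one]
    change (_, _ + _) = _
    ext <;> simp; ring
  | pred n ih =>
    rw [sub_eq_neg_add, zpow_add, LinearEquiv.mul_apply, ih, zpow_neg_one]
    change (_, _ - _) = _
    ext <;> simp; ring

/-- The factor `3` gives `|x + 3ny| ≥ 3|y| - |x| ≥ 2|y|`. With `2` strictness would fail at `x =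
-y`, `n = 1`, and the diagonals belong to `P`. -/
theorem abs_lt_abs_add_three_mul {x y n : ℤ} (hn : n ≠ 0) (hy : y ≠ 0) (h : |x| ≤ |y|) :
    |y| < |x + 3 * n * y| := by
  have h₁ : |3 * n * y| ≤ |x + 3 * n * y| + |x| := by
    simpa using abs_sub (x + 3 * n * y) x
  rw [abs_mul, abs_mul, Nat.abs_ofNat] at h₁
  nlinarith [Int.one_le_abs hn, Int.one_le_abs hy]

/-- The action of the free group on `ℤ²` in which the generators act by shears. -/
def freeGroupShear : FreeGroup (Fin 2) →* ((ℤ × ℤ) ≃ₗ[ℤ] (ℤ × ℤ)) :=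
  FreeGroup.lift ![upperShear, lowerShear]

theorem hasPingPongTranslates_freeGroup : HasPingPongTranslates (FreeGroup (Fin 2)) := by
  let : DistribMulAction (FreeGroup (Fin 2)) (ℤ × ℤ) :=
    DistribMulAction.compHom _ freeGroupShear
  have hsmul (g : FreeGroup (Fin 2)) (v : ℤ × ℤ) : g • v = freeGroupShear g v := rfl
  have ha (n : ℤ) (v : ℤ × ℤ) :
      FreeGroup.of (0 : Fin 2) ^ n • v = (v.1 + 3 * n * v.2, v.2) := by
    rw [hsmul, map_zpow, freeGroupShear, FreeGroup.lift_apply_of, ← upperShear_zpow_apply]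
    rfl
  have hb (n : ℤ) (v : ℤ × ℤ) :
      FreeGroup.of (1 : Fin 2) ^ n • v = (v.1, v.2 + 3 * n * v.1) := by
    rw [hsmul, map_zpow, freeGroupShear, FreeGroup.lift_apply_of, ← lowerShear_zpow_apply]
    rfl
  refine hasPingPongTranslates_of_isNormalForm isNormalForm_freeGroup
    (P := {v : ℤ × ℤ | v.1 ≠ 0 ∧ |v.2| ≤ |v.1|}) (Q := {v | |v.1| < |v.2|})
    (Y := {v | v.1 * v.2 < 0 ∧ |v.2| ≤ |v.1|}) (x₀ := (1, 0)) ?_ ?_ ?_ ?_ ?_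
  · exact Set.disjoint_left.2 fun v hv hv' => hv.2.not_gt hv'
  · intro n hn v hv
    rw [ha]
    have hv2 : v.2 ≠ 0 := abs_pos.1 ((abs_nonneg _).trans_lt hv)
    have h := abs_lt_abs_add_three_mul hn hv2 hv.le
    exact ⟨abs_pos.1 ((abs_nonneg _).trans_lt h), h.le⟩
  · intro n hn v hv
    rw [hb]
    exact abs_lt_abs_add_three_mul hn hv.1 hv.2
  · rintro v ⟨hv, hle⟩
    exact ⟨left_ne_zero_of_mul hv.ne, hle⟩
  · rintro v ⟨g, rfl⟩ hY
    -- The origin is fixed and lies outside `P` and `Y`, so it must be excluded; this is why only an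
    -- orbit is considered.
    have h0 : g • ((1, 0) : ℤ × ℤ) ≠ 0 := (smul_ne_zero_iff_ne g).2 (by simp)
    change g • ((1, 0) : ℤ × ℤ) ∉ _ at hY
    change FreeGroup.of (0 : Fin 2) • g • ((1, 0) : ℤ × ℤ) ∈ _
    generalize g • ((1, 0) : ℤ × ℤ) = v at h0 hY ⊢
    obtain ⟨x, y⟩ := v
    have h1 := ha 1 (x, y)
    rw [zpow_one] at h1
    rw [h1]
    simp only [Set.mem_ofPred_eq, not_and_or, not_lt, not_le, mul_one, Set.mem_sdiff] at hY ⊢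
    rcases eq_or_ne y 0 with rfl | hy
    · have hx : x ≠ 0 := fun hx => h0 (by simp [hx])
      simp [hx]
    -- Either `x y ≥ 0` or `|x| < |y|`; in both cases `x + 3y` has the sign of `y` and dominates it,
    -- so the image lies in `P` with positive coordinate product.
    rcases hY with hY | hY
    · have hy2 : 0 < y * y := mul_self_pos.2 hy
      have hle : |y| ≤ |x + 3 * y| := by
        rw [← sq_le_sq]
        nlinarith [mul_self_nonneg x]
      refine ⟨⟨abs_pos.1 ((abs_pos.2 hy).trans_le hle), hle⟩, Or.inl ?_⟩
      nlinarith
    · have h := abs_lt_abs_add_three_mul one_ne_zero hy hY.le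
      rw [mul_one] at h
      refine ⟨⟨abs_pos.1 ((abs_nonneg _).trans_lt h), h.le⟩, Or.inl ?_⟩
      have := sq_lt_sq.2 hY
      nlinarith

theorem theorem1p1 : HasStableRankOne (reducedGroupCStarAlgebra (FreeGroup (Fin 2))) := by
  exact hasPingPongTranslates_freeGroup.hasStableRankOne
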